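/- Let $\alpha\in(0,\tfrac12)$, let $L:(0,\infty)\to(0,\infty)$ be a (measurable) slowly varying function, and let $\tau=(\tau_n)_{n\ge 0}$ be a recurrent renewal process on the positive integers with $\tau_0=0$ and interarrival distribution $K(n)=P(\tau_1=n)=L(n)\,n^{-(1+\alpha)}$, $n\ge 1$, $\sum_{n\ge1}K(n)=1$. Write $\delta_n=\mathbf 1_{\{n\in\tau\}}$ and let $E$ be the expectation with respect to $\tau$. Independently of $\tau$, let $\omega=(\omega_n)_{n\in\mathbb Z}$ be a stationary Gaussian process with mean $0$ and variance $1$ (law $\mathbb P$, expectation $\mathbb E$), such that for some integer $q\ge 1$ one has $\operatorname{Cov}(\omega_0,\omega_n)=0$ for all $n>q$. For $\beta\ge 0$, $h\in\mathbb R$ and $n\ge1$ put $$Z_{n,\beta,h,\omega}=E\Big[\exp\Big(\sum_{k=1}^n(\beta\omega_k+h)\delta_k\Big)\delta_n\Big],\qquad Z^a_{n,\beta,h}=\mathbb E\,Z_{n,\beta,h,\omega},$$ let $F(\beta,h)=\lim_{n\to\infty}\frac1n\log Z_{n,\beta,h,\omega}$ (limit $\mathbb P$-almost surely and in $L^1(\mathbb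 P)$) and $F^a(\beta,h)=\lim_{n\to\infty}\frac1n\log Z^a_{n,\beta,h}$ be the quenched and annealed free energies, and let $$h_c(\beta)=\sup\{h\in\mathbb R: F(\beta,h)=0\},\qquad h_c^a(\beta)=\sup\{h\in\mathbb R: F^a(\beta,h)=0\}$$ be the quenched and annealed critical points. Then there is $\beta_0\in[0,\infty)$ such that for every $\beta>\beta_0$ both suprema are finite and $h_c(\beta)>h_c^a(\beta)$. -/

import Mathlib

open MeasureTheory ProbabilityTheory Filter Topology

noncomputable section

namespace Pinning

/-- Slowly varying function at infinity: a measurable function, positive on `(0, ∞)`, such that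
`L (c * x) / L x → 1` as `x → ∞`, for every `c > 0`.  (Values of `L` on `(-∞, 0]` are irrelevant.) -/
structure IsSlowlyVarying (L : ℝ → ℝ) : Prop where
  measurable : Measurable L
  pos : ∀ x : ℝ, 0 < x → 0 < L x
  tendsto_div : ∀ c : ℝ, 0 < c → Tendsto (fun x : ℝ => L (c * x) / L x) atTop (𝓝 1)

/-- The interarrival distribution `K n = L n * n ^ (-(1 + α))` for `n ≥ 1`, with no mass at `0`. -/
def interarrivalMass (L : ℝ → ℝ) (α : ℝ) (n : ℕ) : ℝ :=
  if n = 0 then 0 else L n * (n : ℝ) ^ (-(1 + α))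

/-- The sequence `T 0, T 1, …` consists of the interarrival times of a recurrent renewal process
with interarrival distribution `K`: independent `ℕ`-valued random variables with common law `K`.
Recurrence, that is `∑ K n = 1`, is contained in the fact that the `T k` are finite
(`ℕ`-valued) random variables on a probability space. -/
structure IsInterarrivalSequence {Ω : Type*} [MeasurableSpace Ω] (P : Measure Ω)
    (K : ℕ → ℝ) (T : ℕ → Ω → ℕ) : Prop where
  measurable : ∀ k, Measurable (T k)
  indep : iIndepFun T P
  law : ∀ k n, P.real {x | T k x = n} = K n

/-- The renewal epochs `τ_j = T_1 + ⋯ + T_j`, with `τ_0 = 0`; the usual `T_{k+1}` is `T k` here. -/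
def renewalEpoch {Ω : Type*} (T : ℕ → Ω → ℕ) (j : ℕ) (x : Ω) : ℕ :=
  ∑ i ∈ Finset.range j, T i x

/-- `δ_n`, the indicator function of the event `n ∈ τ`. -/
def renewalIndicator {Ω : Type*} (T : ℕ → Ω → ℕ) (n : ℕ) (x : Ω) : ℝ :=
  Set.indicator {y : Ω | ∃ j : ℕ, renewalEpoch T j y = n} (fun _ => (1 : ℝ)) x

/-- A stationary Gaussian sequence indexed by `ℤ`, with mean `0` and variance `1`, whose
correlations `ρ_n = Cov(ω_0, ω_n)` vanish for `n > q`. -/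
structure IsFiniteRangeGaussian {Ω' : Type*} [MeasurableSpace Ω'] (Q : Measure Ω')
    (ω : ℤ → Ω' → ℝ) (q : ℕ) : Prop where
  gaussian : IsGaussianProcess ω Q
  mean_zero : ∀ i : ℤ, ∫ y, ω i y ∂Q = 0
  variance_one : ∀ i : ℤ, variance (ω i) Q = 1
  stationary : ∀ i n : ℤ, covariance (ω i) (ω (i + n)) Q = covariance (ω 0) (ω n) Q
  finite_range : ∀ n : ℤ, (q : ℤ) < n → covariance (ω 0) (ω n) Q = 0

section Model

variable {Ω Ω' : Type*} [MeasurableSpace Ω] [MeasurableSpace Ω']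

/-- The Hamiltonian `H_n = ∑_{k=1}^n (β ω_k + h) δ_k`, for a fixed environment `w : ℤ → ℝ`. -/
def hamiltonian (T : ℕ → Ω → ℕ) (n : ℕ) (β h : ℝ) (w : ℤ → ℝ) (x : Ω) : ℝ :=
  ∑ k ∈ Finset.Icc 1 n, (β * w k + h) * renewalIndicator T k x

/-- The quenched partition function `Z_{n,β,h,w} = E (exp H_n · δ_n)`, the expectation being over
the renewal process only. -/
def quenchedZ (P : Measure Ω) (T : ℕ → Ω → ℕ) (n : ℕ) (β h : ℝ) (w : ℤ → ℝ) : ℝ :=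
  ∫ x, Real.exp (hamiltonian T n β h w x) * renewalIndicator T n x ∂P

/-- The annealed partition function `Z^a_{n,β,h} = 𝔼 Z_{n,β,h,ω}`. -/
def annealedZ (P : Measure Ω) (T : ℕ → Ω → ℕ) (Q : Measure Ω') (ω : ℤ → Ω' → ℝ)
    (n : ℕ) (β h : ℝ) : ℝ :=
  ∫ y, quenchedZ P T n β h (fun i => ω i y) ∂Q

/-- `F` is the quenched free energy `F(β,h)`: the limit of `(1/n) log Z_{n,β,h,ω}`, both almost
surely and in `L¹`. -/
def HasQuenchedFreeEnergy (P : Measure Ω) (T : ℕ → Ω → ℕ) (Q : Measure Ω') (ω : ℤ → Ω' → ℝ)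
    (β h F : ℝ) : Prop :=
  (∀ᵐ y ∂Q, Tendsto (fun n : ℕ => (1 / (n : ℝ)) * Real.log (quenchedZ P T n β h (fun i => ω i y)))
      atTop (𝓝 F)) ∧
  Tendsto (fun n : ℕ => eLpNorm
      (fun y => (1 / (n : ℝ)) * Real.log (quenchedZ P T n β h (fun i => ω i y)) - F) 1 Q)
    atTop (𝓝 0)

/-- `F` is the annealed free energy `F^a(β,h)`: the limit of `(1/n) log Z^a_{n,β,h}`. -/
def HasAnnealedFreeEnergy (P : Measure Ω) (T : ℕ → Ω → ℕ) (Q : Measure Ω') (ω : ℤ → Ω' → ℝ)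
    (β h F : ℝ) : Prop :=
  Tendsto (fun n : ℕ => (1 / (n : ℝ)) * Real.log (annealedZ P T Q ω n β h)) atTop (𝓝 F)

/-- The set `{h : F(β,h) = 0}`. -/
def quenchedDelocalized (P : Measure Ω) (T : ℕ → Ω → ℕ) (Q : Measure Ω') (ω : ℤ → Ω' → ℝ)
    (β : ℝ) : Set ℝ :=
  {h : ℝ | HasQuenchedFreeEnergy P T Q ω β h 0}

/-- The set `{h : F^a(β,h) = 0}`. -/
def annealedDelocalized (P : Measure Ω) (T : ℕ → Ω → ℕ) (Q : Measure Ω') (ω : ℤ → Ω' → ℝ)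
    (β : ℝ) : Set ℝ :=
  {h : ℝ | HasAnnealedFreeEnergy P T Q ω β h 0}

/-- The quenched critical curve `h_c(β) = sup {h : F(β,h) = 0}`. -/
def quenchedCritical (P : Measure Ω) (T : ℕ → Ω → ℕ) (Q : Measure Ω') (ω : ℤ → Ω' → ℝ)
    (β : ℝ) : ℝ :=
  sSup (quenchedDelocalized P T Q ω β)

/-- The annealed critical curve `h_c^a(β) = sup {h : F^a(β,h) = 0}`. -/
def annealedCritical (P : Measure Ω) (T : ℕ → Ω → ℕ) (Q : Measure Ω') (ω : ℤ → Ω' → ℝ)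
    (β : ℝ) : ℝ :=
  sSup (annealedDelocalized P T Q ω β)

end Model

end Pinning

end

noncomputable section

namespace Pinning

/-- Uniform convergence theorem for slowly varying functions, in additive form. -/
theorem exists_forall_abs_sub_le_of_tendsto {f : ℝ → ℝ} (hf : Measurable f)
    (h : ∀ u, Tendsto (fun x => f (x + u) - f x) atTop (𝓝 0)) {ε : ℝ} (hε : 0 < ε) :
    ∃ X : ℝ, ∀ x, X ≤ x → ∀ u ∈ Set.Icc (0 : ℝ) 1, |f (x + u) - f x| ≤ ε := by
  by_contra! hcon
  choose x hx u hu hxu using fun n : ℕ => hcon n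
  have hxT : Tendsto x atTop atTop := tendsto_atTop_mono hx tendsto_natCast_atTop_atTop
  have hyT : Tendsto (fun n => x n + u n) atTop atTop :=
    tendsto_atTop_mono (fun n => by linarith [(hu n).1]) hxT
  have key : ∀ y : ℕ → ℝ, Tendsto y atTop atTop →
      Tendsto (fun n => (volume.restrict (Set.Icc (0 : ℝ) 2))
        {v | ε / 2 ≤ |f (y n + v) - f (y n)|}) atTop (𝓝 0) := by
    intro y hy
    have := (tendstoInMeasure_iff_norm.1 (tendstoInMeasure_of_tendsto_ae
      (μ := volume.restrict (Set.Icc (0 : ℝ) 2)) (f := fun n v => f (y n + v) - f (y n))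
      (g := fun _ => 0) (fun n => ((hf.comp (measurable_const_add _)).sub_const _).aestronglyMeasurable)
      (Eventually.of_forall fun v => (h v).comp hy))) (ε / 2) (by positivity)
    simpa using this
  have hsum := (key x hxT).add (key _ hyT)
  rw [add_zero] at hsum
  have hge : ∀ n, (1 : ENNReal) ≤ (volume.restrict (Set.Icc (0 : ℝ) 2))
        {v | ε / 2 ≤ |f (x n + v) - f (x n)|} + (volume.restrict (Set.Icc (0 : ℝ) 2))
        {v | ε / 2 ≤ |f (x n + u n + v) - f (x n + u n)|} := by
    intro n
    set A := {v | ε / 2 ≤ |f (x n + v) - f (x n)|}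
    set B := {v | ε / 2 ≤ |f (x n + u n + v) - f (x n + u n)|}
    have hA : (volume.restrict (Set.Icc (0 : ℝ) 2)) A = volume (A ∩ Set.Icc 0 2) :=
      Measure.restrict_apply' measurableSet_Icc
    have hB : (volume.restrict (Set.Icc (0 : ℝ) 2)) B
        = volume ((fun v => v + (-u n)) ⁻¹' (B ∩ Set.Icc 0 2)) := by
      rw [measure_preimage_add_right, Measure.restrict_apply' measurableSet_Icc]
    rw [hA, hB]
    have h1 : volume (Set.Icc (1 : ℝ) 2) = 1 := by rw [Real.volume_Icc]; norm_num
    rw [← h1]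
    refine (measure_mono ?_).trans (measure_union_le _ _)
    intro v hv
    have h0 := (hu n).1
    have h2 := (hu n).2
    by_cases hvA : ε / 2 ≤ |f (x n + v) - f (x n)|
    · exact Or.inl ⟨hvA, by linarith [hv.1], hv.2⟩
    · refine Or.inr ⟨?_, by simp only; linarith [hv.1], by linarith [hv.2]⟩
      show ε / 2 ≤ |f (x n + u n + (v + -u n)) - f (x n + u n)|
      rw [show x n + u n + (v + -u n) = x n + v by ring]
      have h3 := abs_sub_abs_le_abs_sub (f (x n + u n) - f (x n)) (f (x n + v) - f (x n))
      rw [show f (x n + u n) - f (x n) - (f (x n + v) - f (x n))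
        = -(f (x n + v) - f (x n + u n)) by ring, abs_neg] at h3
      linarith [hxu n]
  have := ge_of_tendsto' hsum hge
  simp at this

theorem IsSlowlyVarying.exists_abs_log_le {L : ℝ → ℝ} (hL : IsSlowlyVarying L) {ε : ℝ}
    (hε : 0 < ε) :
    ∃ N : ℕ, ∃ C : ℝ, 1 ≤ N ∧ ∀ n : ℕ, N ≤ n → |Real.log (L n)| ≤ C + ε * Real.log n := by
  obtain ⟨X, hX⟩ := exists_forall_abs_sub_le_of_tendsto (f := fun x => Real.log (L (Real.exp x)))
    (Real.measurable_log.comp (hL.measurable.comp Real.measurable_exp)) (fun u => by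
      have h1 := (hL.tendsto_div (Real.exp u) (Real.exp_pos u)).comp Real.tendsto_exp_atTop
      have h2 := (Real.continuousAt_log one_ne_zero).tendsto.comp h1
      rw [Real.log_one] at h2
      refine h2.congr fun x => ?_
      have p1 := (hL.pos _ (Real.exp_pos x)).ne'
      have p2 := (hL.pos _ (mul_pos (Real.exp_pos u) (Real.exp_pos x))).ne'
      simp only [Function.comp]
      rw [Real.log_div p2 p1, ← Real.exp_add, add_comm]) hε
  set f := fun x => Real.log (L (Real.exp x)) with hf
  have hstep : ∀ (k : ℕ), ∀ u ∈ Set.Icc (0 : ℝ) 1, |f (X + k + u)| ≤ |f X| + ε * (k + 1) := by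
    intro k
    induction k with
    | zero =>
      intro u hu
      have := hX X le_rfl u hu
      have h3 := abs_sub_abs_le_abs_sub (f (X + u)) (f X)
      simp only [Nat.cast_zero, add_zero]
      linarith
    | succ k ih =>
      intro u hu
      have h1 := ih 1 ⟨zero_le_one, le_rfl⟩
      have h2 := hX (X + (k + 1)) (by have : (0 : ℝ) ≤ k := k.cast_nonneg
                                      linarith) u hu
      have h3 := abs_sub_abs_le_abs_sub (f (X + (k + 1) + u)) (f (X + (k + 1)))
      push_cast
      rw [show X + k + 1 = X + (k + 1) by ring] at h1
      linarith
  refine ⟨⌈Real.exp X⌉₊ + 1, |f X| + ε * (1 - X), by omega, fun n hn => ?_⟩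
  have hn1 : (0 : ℝ) < n := by
    have : 0 < n := by omega
    exact_mod_cast this
  have hXn : X ≤ Real.log n := by
    rw [Real.le_log_iff_exp_le hn1]
    refine (Nat.le_ceil _).trans ?_
    exact_mod_cast (by omega : ⌈Real.exp X⌉₊ ≤ n)
  have h1 := Nat.floor_le (sub_nonneg.2 hXn)
  have h2 := Nat.lt_floor_add_one (Real.log n - X)
  have h3 := hstep ⌊Real.log n - X⌋₊ (Real.log n - X - ⌊Real.log n - X⌋₊)
    ⟨by linarith, by linarith⟩
  rw [show X + (⌊Real.log n - X⌋₊ : ℝ) + (Real.log n - X - ⌊Real.log n - X⌋₊) = Real.log n by ring]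
    at h3
  simp only [hf, Real.exp_log hn1] at h3 ⊢
  nlinarith [mul_le_mul_of_nonneg_left h1 hε.le]

section Mass

variable {L : ℝ → ℝ} {α : ℝ}

theorem interarrivalMass_zero : interarrivalMass L α 0 = 0 := by simp [interarrivalMass]

theorem interarrivalMass_pos (hL : IsSlowlyVarying L) {n : ℕ} (hn : 1 ≤ n) :
    0 < interarrivalMass L α n := by
  have h : (0 : ℝ) < n := by exact_mod_cast hn
  rw [interarrivalMass, if_neg (by omega)]
  exact mul_pos (hL.pos _ h) (Real.rpow_pos_of_pos h _)

theorem interarrivalMass_nonneg (hL : IsSlowlyVarying L) (n : ℕ) :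
    0 ≤ interarrivalMass L α n := by
  rcases Nat.eq_zero_or_pos n with rfl | hn
  · rw [interarrivalMass_zero]
  · exact (interarrivalMass_pos hL hn).le

theorem log_interarrivalMass (hL : IsSlowlyVarying L) {n : ℕ} (hn : 1 ≤ n) :
    Real.log (interarrivalMass L α n) = Real.log (L n) - (1 + α) * Real.log n := by
  have h : (0 : ℝ) < n := by exact_mod_cast hn
  rw [interarrivalMass, if_neg (by omega), Real.log_mul (hL.pos _ h).ne'
    (Real.rpow_pos_of_pos h _).ne', Real.log_rpow h]
  ring

theorem tendsto_log_natCast_div : Tendsto (fun n : ℕ => Real.log n / n) atTop (𝓝 0) :=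
  (Real.isLittleO_log_id_atTop.tendsto_div_nhds_zero).comp tendsto_natCast_atTop_atTop

theorem tendsto_abs_log_interarrivalMass_div (hL : IsSlowlyVarying L) :
    Tendsto (fun n : ℕ => |Real.log (interarrivalMass L α n)| / n) atTop (𝓝 0) := by
  obtain ⟨N, C, hN, h⟩ := hL.exists_abs_log_le one_pos
  have h0 : Tendsto (fun n : ℕ => C / n + (1 + |1 + α|) * (Real.log n / n)) atTop (𝓝 0) := by
    simpa using (tendsto_const_div_atTop_nhds_zero_nat C).add
      (tendsto_log_natCast_div.const_mul (1 + |1 + α|))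
  refine squeeze_zero' (Eventually.of_forall fun n => by positivity) ?_ h0
  filter_upwards [eventually_ge_atTop N] with n hn
  have hn1 : (0 : ℝ) < n := by exact_mod_cast (by omega : 0 < n)
  have hlog : 0 ≤ Real.log n := Real.log_natCast_nonneg n
  rw [show C / n + (1 + |1 + α|) * (Real.log n / n) = (C + (1 + |1 + α|) * Real.log n) / n by ring]
  gcongr
  rw [log_interarrivalMass hL (by omega)]
  have h1 := abs_sub (Real.log (L n)) ((1 + α) * Real.log n)
  rw [abs_mul, abs_of_nonneg hlog] at h1
  linarith [h n hn]

theorem exists_summable_interarrivalMass_rpow (hL : IsSlowlyVarying L) (hα : 0 < α) :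
    ∃ γ : ℝ, 0 < γ ∧ γ < 1 ∧ Summable (fun n : ℕ => interarrivalMass L α n ^ γ) := by
  obtain ⟨N, C, hN, h⟩ := hL.exists_abs_log_le (half_pos hα)
  refine ⟨(1 + α / 4) / (1 + α / 2), by positivity, ?_, ?_⟩
  · rw [div_lt_one (by positivity)]; linarith
  set γ := (1 + α / 4) / (1 + α / 2) with hγ
  have hγ0 : 0 < γ := by positivity
  have hγ1 : γ * (1 + α / 2) = 1 + α / 4 := by rw [hγ]; field_simp
  have hs : Summable (fun n : ℕ => Real.exp (γ * C) * (1 / (n : ℝ) ^ (1 + α / 4))) :=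
    (Real.summable_one_div_nat_rpow.2 (by linarith)).mul_left _
  refine Summable.of_norm_bounded_eventually_nat hs ?_
  filter_upwards [eventually_ge_atTop N] with n hn
  have hn1 : (0 : ℝ) < n := by exact_mod_cast (by omega : 0 < n)
  have hK := interarrivalMass_pos (α := α) hL (by omega : 1 ≤ n)
  rw [Real.norm_of_nonneg (Real.rpow_nonneg hK.le _), Real.rpow_def_of_pos hK,
    log_interarrivalMass hL (by omega), Real.rpow_def_of_pos hn1, one_div, ← Real.exp_neg,
    ← Real.exp_add]
  refine Real.exp_le_exp.2 ?_
  have h1 := (le_abs_self _).trans (h n hn)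
  have h2 : (Real.log (L n) - (1 + α) * Real.log n) * γ
      ≤ (C + α / 2 * Real.log n - (1 + α) * Real.log n) * γ := by gcongr
  refine h2.trans (le_of_eq ?_)
  rw [← hγ1]; ring

end Mass

theorem add_le_of_strictMono {s : ℕ → ℤ} (hs : StrictMono s) (i d : ℕ) : s i + d ≤ s (i + d) := by
  induction d with
  | zero => simp
  | succ d ih =>
    have := hs (show i + d < i + (d + 1) by omega)
    push_cast
    omega

namespace IsFiniteRangeGaussian

variable {Ω' : Type*} [MeasurableSpace Ω'] {Q : Measure Ω'} {ω : ℤ → Ω' → ℝ} {q : ℕ}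

theorem memLp_two (hω : IsFiniteRangeGaussian Q ω q) (i : ℤ) : MemLp (ω i) 2 Q :=
  (hω.gaussian.hasGaussianLaw_eval i).memLp_two

theorem integrable (hω : IsFiniteRangeGaussian Q ω q) (i : ℤ) : Integrable (ω i) Q :=
  (hω.gaussian.hasGaussianLaw_eval i).integrable

theorem memLp_two_sum (hω : IsFiniteRangeGaussian Q ω q) (s : ℕ → ℤ) (j : ℕ) :
    MemLp (fun y => ∑ i ∈ Finset.range j, ω (s i) y) 2 Q :=
  memLp_finsetSum _ fun i _ => hω.memLp_two (s i)

theorem integral_sum (hω : IsFiniteRangeGaussian Q ω q) (s : ℕ → ℤ) (j : ℕ) :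
    ∫ y, ∑ i ∈ Finset.range j, ω (s i) y ∂Q = 0 := by
  rw [integral_finsetSum _ fun i _ => hω.integrable (s i)]
  exact Finset.sum_eq_zero fun i _ => hω.mean_zero _

theorem covariance_eq (hω : IsFiniteRangeGaussian Q ω q) (i k : ℤ) :
    covariance (ω i) (ω k) Q = covariance (ω 0) (ω (k - i)) Q := by
  rw [← hω.stationary i (k - i), add_sub_cancel]

theorem covariance_eq_zero (hω : IsFiniteRangeGaussian Q ω q) {i k : ℤ}
    (h : i + q < k ∨ k + q < i) : covariance (ω i) (ω k) Q = 0 := by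
  rcases h with h | h
  · rw [hω.covariance_eq]; exact hω.finite_range _ (by omega)
  · rw [covariance_comm, hω.covariance_eq]; exact hω.finite_range _ (by omega)

theorem covariance_le_one [IsProbabilityMeasure Q] (hω : IsFiniteRangeGaussian Q ω q) (i k : ℤ) :
    covariance (ω i) (ω k) Q ≤ 1 := by
  have h := variance_sub (hω.memLp_two i) (hω.memLp_two k)
  have h0 := variance_nonneg (ω i - ω k) Q
  rw [hω.variance_one, hω.variance_one] at h
  linarith

theorem variance_sum (hω : IsFiniteRangeGaussian Q ω q) [IsProbabilityMeasure Q] (s : ℕ → ℤ)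
    (j : ℕ) :
    variance (fun y => ∑ i ∈ Finset.range j, ω (s i) y) Q =
      ∑ i ∈ Finset.range j, ∑ k ∈ Finset.range j, covariance (ω (s i)) (ω (s k)) Q := by
  rw [← covariance_self (hω.memLp_two_sum s j).aemeasurable,
    covariance_fun_sum_fun_sum' (fun i _ => hω.memLp_two _) (fun i _ => hω.memLp_two _)]

theorem variance_sum_congr (hω : IsFiniteRangeGaussian Q ω q) [IsProbabilityMeasure Q]
    {s s' : ℕ → ℤ} {j : ℕ} {c : ℤ} (h : ∀ i < j, s' i = s i + c) :
    variance (fun y => ∑ i ∈ Finset.range j, ω (s' i) y) Q =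
      variance (fun y => ∑ i ∈ Finset.range j, ω (s i) y) Q := by
  rw [hω.variance_sum, hω.variance_sum]
  refine Finset.sum_congr rfl fun i hi => Finset.sum_congr rfl fun k hk => ?_
  rw [h i (Finset.mem_range.1 hi), h k (Finset.mem_range.1 hk), hω.covariance_eq,
    hω.covariance_eq (s i), add_sub_add_right_eq_sub]

theorem variance_sum_le (hω : IsFiniteRangeGaussian Q ω q) [IsProbabilityMeasure Q] {s : ℕ → ℤ}
    (hs : StrictMono s) (j : ℕ) :
    variance (fun y => ∑ i ∈ Finset.range j, ω (s i) y) Q ≤ (2 * q + 1) * j := by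
  rw [hω.variance_sum]
  have key : ∀ i, ∑ k ∈ Finset.range j, covariance (ω (s i)) (ω (s k)) Q ≤ 2 * q + 1 := by
    intro i
    have h1 : ∀ k ∈ Finset.range j, covariance (ω (s i)) (ω (s k)) Q
        ≤ if k ∈ Finset.Icc (i - q) (i + q) then 1 else 0 := by
      intro k _
      split_ifs with hk
      · exact hω.covariance_le_one _ _
      · refine (hω.covariance_eq_zero ?_).le
        rw [Finset.mem_Icc, not_and_or, not_le, not_le] at hk
        rcases hk with hk | hk
        · right
          have := add_le_of_strictMono hs k (i - k)
          rw [Nat.add_sub_cancel' (by omega)] at this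
          omega
        · left
          have := add_le_of_strictMono hs i (k - i)
          rw [Nat.add_sub_cancel' (by omega)] at this
          omega
    refine (Finset.sum_le_sum h1).trans ?_
    rw [← Finset.sum_filter, Finset.sum_const, nsmul_eq_mul, mul_one]
    have h2 : (Finset.filter (fun k => k ∈ Finset.Icc (i - q) (i + q)) (Finset.range j)).card
        ≤ 2 * q + 1 := by
      refine (Finset.card_le_card (t := Finset.Icc (i - q) (i + q))
        fun k hk => (Finset.mem_filter.1 hk).2).trans ?_
      rw [Nat.card_Icc]
      omega
    exact_mod_cast h2
  refine (Finset.sum_le_sum fun i _ => key i).trans (le_of_eq ?_)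
  rw [Finset.sum_const, Finset.card_range, nsmul_eq_mul, mul_comm]

theorem map_sum_eq (hω : IsFiniteRangeGaussian Q ω q) (s : ℕ → ℤ) (j : ℕ) :
    Q.map (fun y => ∑ i ∈ Finset.range j, ω (s i) y) = gaussianReal 0
      (variance (fun y => ∑ i ∈ Finset.range j, ω (s i) y) Q).toNNReal := by
  have h := ((hω.gaussian.comp_right s).hasGaussianLaw_fun_sum
    (I := Finset.range j)).map_eq_gaussianReal
  simp only [Function.comp] at h
  rw [hω.integral_sum] at h
  exact h

theorem integrable_exp_sum (hω : IsFiniteRangeGaussian Q ω q) (s : ℕ → ℤ) (j : ℕ) (c : ℝ) :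
    Integrable (fun y => Real.exp (c * ∑ i ∈ Finset.range j, ω (s i) y)) Q := by
  have h := integrable_exp_mul_gaussianReal (μ := 0)
    (v := (variance (fun y => ∑ i ∈ Finset.range j, ω (s i) y) Q).toNNReal) c
  rw [← hω.map_sum_eq] at h
  exact h.comp_aemeasurable (hω.memLp_two_sum s j).aemeasurable

theorem integral_exp_sum (hω : IsFiniteRangeGaussian Q ω q) (s : ℕ → ℤ) (j : ℕ) (c : ℝ) :
    ∫ y, Real.exp (c * ∑ i ∈ Finset.range j, ω (s i) y) ∂Q =
      Real.exp (c ^ 2 * variance (fun y => ∑ i ∈ Finset.range j, ω (s i) y) Q / 2) := by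
  have h := mgf_gaussianReal (hω.map_sum_eq s j) c
  rw [mgf] at h
  rw [h, Real.coe_toNNReal _ (variance_nonneg _ _)]
  ring_nf

theorem integral_sq (hω : IsFiniteRangeGaussian Q ω q) (i : ℤ) : ∫ y, ω i y ^ 2 ∂Q = 1 := by
  rw [← hω.variance_one i, variance_of_integral_eq_zero (hω.integrable i).aemeasurable
    (hω.mean_zero i)]

theorem variance_sum_mul (hω : IsFiniteRangeGaussian Q ω q) [IsProbabilityMeasure Q]
    {s s' : ℕ → ℤ} (hs : StrictMono s) {j : ℕ}
    (hgap : ∀ m i, i < m * j → s i + q < s (m * j))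
    (hcopy : ∀ m, ∃ c : ℤ, ∀ i < j, s (m * j + i) = s' i + c) (m : ℕ) :
    variance (fun y => ∑ i ∈ Finset.range (m * j), ω (s i) y) Q =
      m * variance (fun y => ∑ i ∈ Finset.range j, ω (s' i) y) Q := by
  induction m with
  | zero =>
    simp only [zero_mul, Finset.range_zero, Finset.sum_empty, Nat.cast_zero]
    exact variance_zero Q
  | succ m ih =>
    obtain ⟨c, hc⟩ := hcopy m
    have h1 : (fun y => ∑ i ∈ Finset.range ((m + 1) * j), ω (s i) y) =
        (fun y => ∑ i ∈ Finset.range (m * j), ω (s i) y) +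
          fun y => ∑ i ∈ Finset.range j, ω (s (m * j + i)) y := by
      funext y
      rw [Nat.succ_mul, Finset.sum_range_add]
      rfl
    rw [h1, variance_add (hω.memLp_two_sum _ _) (hω.memLp_two_sum (fun i => s (m * j + i)) _), ih,
      hω.variance_sum_congr (s' := fun i => s (m * j + i)) hc,
      covariance_fun_sum_fun_sum' (fun i _ => hω.memLp_two _) (fun i _ => hω.memLp_two _),
      Finset.sum_eq_zero]
    · push_cast; ring
    · intro i hi
      refine Finset.sum_eq_zero fun k _ => hω.covariance_eq_zero (Or.inl ?_)
      have := hs.monotone (show m * j ≤ m * j + k by omega)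
      have := hgap m i (Finset.mem_range.1 hi)
      omega

end IsFiniteRangeGaussian

/-- The partial sums `t 0 + ⋯ + t (j - 1)` of a sequence of gaps. -/
def gapSum (t : ℕ → ℕ) (j : ℕ) : ℕ := ∑ i ∈ Finset.range j, t i

theorem strictMono_gapSum {t : ℕ → ℕ} (ht : ∀ i, 1 ≤ t i) : StrictMono (gapSum t) :=
  strictMono_nat_of_lt_succ fun n => by
    rw [gapSum, gapSum, Finset.sum_range_succ]
    have := ht n
    omega

theorem strictMono_natCast_gapSum_succ {t : ℕ → ℕ} (ht : ∀ i, 1 ≤ t i) :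
    StrictMono (fun i => (gapSum t (i + 1) : ℤ)) := fun a b hab => by
  have := strictMono_gapSum ht (show a + 1 < b + 1 by omega)
  simpa using this

/-- The variance of the sum of the disorder over the first `j` points with gaps `t`. -/
def gapVariance {Ω' : Type*} [MeasurableSpace Ω'] (Q : Measure Ω') (ω : ℤ → Ω' → ℝ)
    (t : ℕ → ℕ) (j : ℕ) : ℝ :=
  variance (fun y => ∑ i ∈ Finset.range j, ω (gapSum t (i + 1) : ℤ) y) Q

/-- The gaps `t 0, …, t (j - 1)` repeated periodically, with the first gap of every period
increased by `q`. -/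
def spacedRepeat (q j : ℕ) (t : ℕ → ℕ) (i : ℕ) : ℕ :=
  t (i % j) + if i % j = 0 then q else 0

@[to_additive]
theorem prod_range_of_periodic {M : Type*} [CommMonoid M] {f : ℕ → M} {j : ℕ}
    (hf : ∀ i, f (i + j) = f i) (m : ℕ) :
    ∏ i ∈ Finset.range (m * j), f i = (∏ i ∈ Finset.range j, f i) ^ m := by
  have h : ∀ m i, f (m * j + i) = f i := by
    intro m i
    induction m with
    | zero => simp
    | succ m ih => rw [← ih, ← hf (m * j + i)]; ring_nf
  induction m with
  | zero => simp
  | succ m ih => rw [Nat.succ_mul, Finset.prod_range_add, ih, pow_succ]; simp only [h]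

theorem spacedRepeat_add (q j : ℕ) (t : ℕ → ℕ) (i : ℕ) :
    spacedRepeat q j t (i + j) = spacedRepeat q j t i := by
  simp [spacedRepeat]

theorem one_le_spacedRepeat {q j : ℕ} {t : ℕ → ℕ} (ht : ∀ i, 1 ≤ t i) (i : ℕ) :
    1 ≤ spacedRepeat q j t i := (ht _).trans (Nat.le_add_right _ _)

theorem gapSum_spacedRepeat_mul (q j : ℕ) (t : ℕ → ℕ) (m : ℕ) :
    gapSum (spacedRepeat q j t) (m * j) = m * gapSum (spacedRepeat q j t) j := by
  have := sum_range_of_periodic (f := spacedRepeat q j t) (spacedRepeat_add q j t) m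
  simpa [gapSum] using this

theorem gapSum_spacedRepeat_mul_add {q j : ℕ} {t : ℕ → ℕ} (m : ℕ) {i : ℕ} (hi : i < j) :
    gapSum (spacedRepeat q j t) (m * j + i + 1) =
      gapSum t (i + 1) + (q + gapSum (spacedRepeat q j t) (m * j)) := by
  have h : ∀ r ∈ Finset.range (i + 1), spacedRepeat q j t (m * j + r) =
      t r + if r = 0 then q else 0 := by
    intro r hr
    have : r < j := by have := Finset.mem_range.1 hr; omega
    rw [spacedRepeat, Nat.mul_add_mod', Nat.mod_eq_of_lt this]
  rw [add_assoc, gapSum, Finset.sum_range_add, Finset.sum_congr rfl h, Finset.sum_add_distrib,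
    Finset.sum_ite_eq' (Finset.range (i + 1)) 0 (fun _ => q), if_pos (by simp)]
  simp only [gapSum]
  omega

theorem IsFiniteRangeGaussian.gapVariance_spacedRepeat {Ω' : Type*} [MeasurableSpace Ω']
    {Q : Measure Ω'} {ω : ℤ → Ω' → ℝ} {q : ℕ}
    (hω : IsFiniteRangeGaussian Q ω q) [IsProbabilityMeasure Q] {t : ℕ → ℕ} (ht : ∀ i, 1 ≤ t i)
    {j : ℕ} (hj : 0 < j) (m : ℕ) :
    gapVariance Q ω (spacedRepeat q j t) (m * j) = m * gapVariance Q ω t j := by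
  have ht' := one_le_spacedRepeat (q := q) (j := j) ht
  refine hω.variance_sum_mul (s := fun i => (gapSum (spacedRepeat q j t) (i + 1) : ℤ))
    (s' := fun i => (gapSum t (i + 1) : ℤ)) (strictMono_natCast_gapSum_succ ht') ?_ ?_ m
  · intro m i hi
    have h1 := gapSum_spacedRepeat_mul_add (q := q) (t := t) m hj
    have h2 := (strictMono_gapSum ht').monotone (show i + 1 ≤ m * j by omega)
    have h3 := (strictMono_gapSum ht) (show 0 < 0 + 1 by omega)
    rw [add_zero] at h1
    omega
  · intro m
    refine ⟨(q + gapSum (spacedRepeat q j t) (m * j) : ℕ), fun i hi => ?_⟩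
    rw [gapSum_spacedRepeat_mul_add m hi, Nat.cast_add]

theorem rpow_finsetSum_le_finsetSum_rpow {ι : Type*} (s : Finset ι) {f : ι → ℝ}
    (hf : ∀ i, 0 ≤ f i) {γ : ℝ} (h0 : 0 < γ) (h1 : γ ≤ 1) :
    (∑ i ∈ s, f i) ^ γ ≤ ∑ i ∈ s, f i ^ γ := by
  classical
  induction s using Finset.induction_on with
  | empty => simp [Real.zero_rpow h0.ne']
  | insert a s ha ih =>
    rw [Finset.sum_insert ha, Finset.sum_insert ha]
    exact (Real.rpow_add_le_add_rpow (hf a) (Finset.sum_nonneg fun i _ => hf i) h0.le h1).trans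
      (by linarith)

/-- The energy collected at the first `j` renewal points with gaps `t`. -/
def gapEnergy (β h : ℝ) (w : ℤ → ℝ) (t : ℕ → ℕ) (j : ℕ) : ℝ :=
  ∑ i ∈ Finset.range j, (β * w (gapSum t (i + 1) : ℤ) + h)

theorem gapEnergy_eq (β h : ℝ) (w : ℤ → ℝ) (t : ℕ → ℕ) (j : ℕ) :
    gapEnergy β h w t j = β * ∑ i ∈ Finset.range j, w (gapSum t (i + 1) : ℤ) + j * h := by
  rw [gapEnergy, Finset.sum_add_distrib, ← Finset.mul_sum, Finset.sum_const, Finset.card_range,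
    nsmul_eq_mul]

theorem gapSum_congr {t t' : ℕ → ℕ} {j : ℕ} (h : ∀ i < j, t i = t' i) {k : ℕ} (hk : k ≤ j) :
    gapSum t k = gapSum t' k :=
  Finset.sum_congr rfl fun i hi => h i (by have := Finset.mem_range.1 hi; omega)

theorem gapEnergy_congr {β h : ℝ} {w : ℤ → ℝ} {t t' : ℕ → ℕ} {j : ℕ} (H : ∀ i < j, t i = t' i) :
    gapEnergy β h w t j = gapEnergy β h w t' j :=
  Finset.sum_congr rfl fun i hi => by
    rw [gapSum_congr H (by have := Finset.mem_range.1 hi; omega)]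

/-- A finite sequence of gaps, continued by `1`. -/
def extendGaps {j : ℕ} (t : Fin j → ℕ) (i : ℕ) : ℕ := if h : i < j then t ⟨i, h⟩ else 1

theorem extendGaps_coe {j : ℕ} (t : Fin j → ℕ) (i : Fin j) : extendGaps t i = t i := by
  simp [extendGaps]

/-- The finite gap sequences of length `j` with gaps between `1` and `n`. -/
def gapBox (n j : ℕ) : Finset (Fin j → ℕ) := Fintype.piFinset fun _ => Finset.Icc 1 n

theorem one_le_extendGaps {n j : ℕ} {t : Fin j → ℕ} (ht : t ∈ gapBox n j) (i : ℕ) :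
    1 ≤ extendGaps t i := by
  rw [extendGaps]
  split_ifs with h
  · exact (Finset.mem_Icc.1 (Fintype.mem_piFinset.1 ht ⟨i, h⟩)).1
  · exact le_rfl

section Renewal

variable {Ω : Type*}

theorem renewalIndicator_nonneg (T : ℕ → Ω → ℕ) (n : ℕ) (x : Ω) : 0 ≤ renewalIndicator T n x :=
  Set.indicator_nonneg (fun _ _ => zero_le_one) x

theorem renewalIndicator_le_one (T : ℕ → Ω → ℕ) (n : ℕ) (x : Ω) : renewalIndicator T n x ≤ 1 :=
  Set.indicator_le_self' (fun _ _ => zero_le_one) x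

theorem renewalIndicator_of_eq {T : ℕ → Ω → ℕ} {n j : ℕ} {x : Ω}
    (h : gapSum (fun i => T i x) j = n) : renewalIndicator T n x = 1 :=
  Set.indicator_of_mem (s := {y : Ω | ∃ j : ℕ, renewalEpoch T j y = n}) ⟨j, h⟩ _

theorem renewalIndicator_of_forall_ne {T : ℕ → Ω → ℕ} {n : ℕ} {x : Ω}
    (h : ∀ j, gapSum (fun i => T i x) j ≠ n) : renewalIndicator T n x = 0 :=
  Set.indicator_of_notMem (s := {y : Ω | ∃ j : ℕ, renewalEpoch T j y = n})
    (fun ⟨j, hj⟩ => h j hj) _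

theorem hamiltonian_eq_gapEnergy {T : ℕ → Ω → ℕ} {n j : ℕ} {x : Ω} (hpos : ∀ i, 1 ≤ T i x)
    (hj : gapSum (fun i => T i x) j = n) (β h : ℝ) (w : ℤ → ℝ) :
    hamiltonian T n β h w x = gapEnergy β h w (fun i => T i x) j := by
  set τ := gapSum (fun i => T i x) with hτ
  have hmono : StrictMono τ := strictMono_gapSum hpos
  have hinj : Set.InjOn (fun i => τ (i + 1)) (Finset.range j) := fun a _ b _ hab => by
    have := hmono.injective hab
    omega
  rw [hamiltonian, gapEnergy]
  have h1 : ∀ i ∈ Finset.range j, β * w (τ (i + 1) : ℤ) + h =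
      (β * w (τ (i + 1) : ℤ) + h) * renewalIndicator T (τ (i + 1)) x := fun i _ => by
    rw [renewalIndicator_of_eq rfl, mul_one]
  rw [Finset.sum_congr rfl h1, ← Finset.sum_image
    (f := fun k : ℕ => (β * w (k : ℤ) + h) * renewalIndicator T k x) hinj]
  symm
  refine Finset.sum_subset ?_ ?_
  · intro k hk
    obtain ⟨i, hi, rfl⟩ := Finset.mem_image.1 hk
    rw [Finset.mem_Icc, ← hj]
    have := Finset.mem_range.1 hi
    have h2 := hmono (show 0 < i + 1 by omega)
    exact ⟨by omega, hmono.monotone (by omega)⟩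
  · intro k hk hk'
    rw [renewalIndicator_of_forall_ne, mul_zero]
    intro i hi
    rw [Finset.mem_Icc, ← hj, ← hi] at hk
    have h2 : i ≤ j := hmono.le_iff_le.1 hk.2
    have h3 : i ≠ 0 := by
      rintro rfl
      have : gapSum (fun i => T i x) 0 = 0 := rfl
      omega
    refine hk' (Finset.mem_image.2 ⟨i - 1, Finset.mem_range.2 (by omega), ?_⟩)
    simp only [Nat.sub_add_cancel (Nat.pos_of_ne_zero h3)]
    exact hi

variable [MeasurableSpace Ω] {P : Measure Ω} {K : ℕ → ℝ} {T : ℕ → Ω → ℕ}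

theorem measurable_renewalIndicator (hT : ∀ k, Measurable (T k)) (n : ℕ) :
    Measurable (renewalIndicator T n) := by
  refine measurable_const.indicator ?_
  rw [Set.ofPred_exists]
  refine MeasurableSet.iUnion fun j => ?_
  exact (Finset.measurable_sum (Finset.range j) fun i _ => hT i) (measurableSet_singleton n)

theorem measurable_exp_hamiltonian_mul (hT : ∀ k, Measurable (T k)) (n : ℕ) (β h : ℝ) :
    Measurable fun p : (ℤ → ℝ) × Ω =>
      Real.exp (hamiltonian T n β h p.1 p.2) * renewalIndicator T n p.2 := by
  have hi := fun k => (measurable_renewalIndicator hT k).comp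
    (measurable_snd : Measurable (Prod.snd : (ℤ → ℝ) × Ω → Ω))
  refine (Real.measurable_exp.comp ?_).mul (hi n)
  refine Finset.measurable_sum _ fun k _ => ?_
  exact ((((measurable_pi_apply (k : ℤ)).comp measurable_fst).const_mul β).add_const h).mul (hi k)

theorem measurable_quenchedZ [IsProbabilityMeasure P] (hT : ∀ k, Measurable (T k)) (n : ℕ)
    (β h : ℝ) : Measurable (quenchedZ P T n β h) :=
  ((measurable_exp_hamiltonian_mul hT n β h).stronglyMeasurable.integral_prod_right'
    (ν := P)).measurable

theorem quenchedZ_nonneg (n : ℕ) (β h : ℝ) (w : ℤ → ℝ) : 0 ≤ quenchedZ P T n β h w :=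
  integral_nonneg fun x => mul_nonneg (Real.exp_pos _).le (renewalIndicator_nonneg T n x)

theorem integrable_exp_hamiltonian_mul [IsProbabilityMeasure P] (hT : ∀ k, Measurable (T k))
    (n : ℕ) (β h : ℝ) (w : ℤ → ℝ) :
    Integrable (fun x => Real.exp (hamiltonian T n β h w x) * renewalIndicator T n x) P := by
  refine Integrable.of_bound (C := Real.exp (∑ k ∈ Finset.Icc 1 n, |β * w k + h|))
    ((measurable_exp_hamiltonian_mul hT n β h).comp measurable_prodMk_left).aestronglyMeasurable
    (Eventually.of_forall fun x => ?_)
  rw [Real.norm_of_nonneg (mul_nonneg (Real.exp_pos _).le (renewalIndicator_nonneg T n x)),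
    ← mul_one (Real.exp (∑ k ∈ Finset.Icc 1 n, |β * w k + h|))]
  refine mul_le_mul (Real.exp_le_exp.2 (Finset.sum_le_sum fun k _ => ?_))
    (renewalIndicator_le_one T n x) (renewalIndicator_nonneg T n x) (Real.exp_pos _).le
  refine (le_abs_self _).trans ?_
  rw [abs_mul, abs_of_nonneg (renewalIndicator_nonneg T k x)]
  exact mul_le_of_le_one_right (abs_nonneg _) (renewalIndicator_le_one T k x)

namespace IsInterarrivalSequence

theorem ae_one_le [IsProbabilityMeasure P] (hT : IsInterarrivalSequence P K T) (hK : K 0 = 0) :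
    ∀ᵐ x ∂P, ∀ i, 1 ≤ T i x := by
  rw [ae_all_iff]
  intro i
  have h := hT.law i 0
  rw [hK, measureReal_eq_zero_iff] at h
  rw [ae_iff]
  convert h using 3
  ext x
  simp

/-- The probability that the first `j` interarrival times are given by `t`. -/
theorem measureReal_cylinder [IsProbabilityMeasure P] (hT : IsInterarrivalSequence P K T)
    (t : ℕ → ℕ) (j : ℕ) :
    P.real {x | ∀ i < j, T i x = t i} = ∏ i ∈ Finset.range j, K (t i) := by
  have h := hT.indep.measure_inter_preimage_eq_mul (Finset.range j) (sets := fun i => {t i})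
    (fun i _ => measurableSet_singleton _)
  have h1 : {x | ∀ i < j, T i x = t i} = ⋂ i ∈ Finset.range j, T i ⁻¹' {t i} := by
    ext x; simp
  rw [h1, measureReal_def, h, ENNReal.toReal_prod]
  exact Finset.prod_congr rfl fun i _ => hT.law i (t i)

theorem measurableSet_cylinder (hT : IsInterarrivalSequence P K T) (t : ℕ → ℕ) (j : ℕ) :
    MeasurableSet {x | ∀ i < j, T i x = t i} := by
  have h1 : {x | ∀ i < j, T i x = t i} = ⋂ i ∈ Finset.range j, T i ⁻¹' {t i} := by
    ext x; simp
  rw [h1]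
  exact Finset.measurableSet_biInter _ fun i _ => hT.measurable i (measurableSet_singleton _)

theorem prod_mul_exp_le_quenchedZ [IsProbabilityMeasure P] (hT : IsInterarrivalSequence P K T)
    (hK : K 0 = 0) {t : ℕ → ℕ} {n j : ℕ} (hn : gapSum t j = n) (β h : ℝ) (w : ℤ → ℝ) :
    (∏ i ∈ Finset.range j, K (t i)) * Real.exp (gapEnergy β h w t j) ≤ quenchedZ P T n β h w := by
  have hm := hT.measurableSet_cylinder t j
  rw [← hT.measureReal_cylinder t j, ← smul_eq_mul, ← integral_indicator_const _ hm]
  refine integral_mono_ae ((integrable_const _).indicator hm)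
    (integrable_exp_hamiltonian_mul hT.measurable n β h w) ?_
  filter_upwards [hT.ae_one_le hK] with x hx
  by_cases hxc : ∀ i < j, T i x = t i
  · rw [Set.indicator_of_mem (s := {x | ∀ i < j, T i x = t i}) hxc]
    have hj : gapSum (fun i => T i x) j = n := by rw [← hn]; exact gapSum_congr hxc le_rfl
    rw [hamiltonian_eq_gapEnergy hx hj, renewalIndicator_of_eq hj, mul_one, gapEnergy_congr hxc]
  · rw [Set.indicator_of_notMem (s := {x | ∀ i < j, T i x = t i}) hxc]
    exact mul_nonneg (Real.exp_pos _).le (renewalIndicator_nonneg T n x)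

theorem quenchedZ_le_sum [IsProbabilityMeasure P] (hT : IsInterarrivalSequence P K T)
    (hK : K 0 = 0) (n : ℕ) (β h : ℝ) (w : ℤ → ℝ) :
    quenchedZ P T n β h w ≤ ∑ j ∈ Finset.range (n + 1), ∑ t ∈ gapBox n j,
      (∏ i, K (t i)) * Real.exp (gapEnergy β h w (extendGaps t) j) := by
  let g : (j : ℕ) → (Fin j → ℕ) → Ω → ℝ := fun j t =>
    Set.indicator {x | ∀ i < j, T i x = extendGaps t i}
      (fun _ => Real.exp (gapEnergy β h w (extendGaps t) j))
  have hg0 : ∀ j t x, 0 ≤ g j t x := fun j t x =>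
    Set.indicator_nonneg (fun _ _ => (Real.exp_pos _).le) x
  have hgi : ∀ j t, Integrable (g j t) P := fun j t =>
    (integrable_const _).indicator (hT.measurableSet_cylinder _ _)
  have hint : ∫ x, ∑ j ∈ Finset.range (n + 1), ∑ t ∈ gapBox n j, g j t x ∂P =
      ∑ j ∈ Finset.range (n + 1), ∑ t ∈ gapBox n j,
        (∏ i, K (t i)) * Real.exp (gapEnergy β h w (extendGaps t) j) := by
    rw [integral_finsetSum _ fun j _ => integrable_finsetSum _ fun t _ => hgi j t]
    refine Finset.sum_congr rfl fun j _ => ?_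
    rw [integral_finsetSum _ fun t _ => hgi j t]
    refine Finset.sum_congr rfl fun t _ => ?_
    rw [integral_indicator_const _ (hT.measurableSet_cylinder _ _), hT.measureReal_cylinder,
      smul_eq_mul, Finset.prod_range]
    simp only [extendGaps_coe]
  rw [← hint]
  refine integral_mono_ae (integrable_exp_hamiltonian_mul hT.measurable n β h w)
    (integrable_finsetSum _ fun j _ => integrable_finsetSum _ fun t _ => hgi j t) ?_
  filter_upwards [hT.ae_one_le hK] with x hx
  by_cases hex : ∃ j, gapSum (fun i => T i x) j = n
  · obtain ⟨j, hj⟩ := hex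
    have hjn : j ≤ n := by
      rw [← hj]; exact (strictMono_gapSum hx).le_apply
    let t : Fin j → ℕ := fun i => T i x
    have hcyl : ∀ i < j, T i x = extendGaps t i := fun i hi => by simp [extendGaps, hi, t]
    have ht : t ∈ gapBox n j := Fintype.mem_piFinset.2 fun i => Finset.mem_Icc.2 ⟨hx i, by
      rw [← hj]
      exact Finset.single_le_sum (f := fun i => T i x) (fun _ _ => Nat.zero_le _)
        (Finset.mem_range.2 i.2)⟩
    have h1 : g j t x = Real.exp (hamiltonian T n β h w x) * renewalIndicator T n x := by
      rw [hamiltonian_eq_gapEnergy hx hj, renewalIndicator_of_eq hj, mul_one,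
        gapEnergy_congr hcyl]
      exact Set.indicator_of_mem (s := {x | ∀ i < j, T i x = extendGaps t i}) hcyl _
    rw [← h1]
    exact (Finset.single_le_sum (f := fun t => g j t x) (fun t _ => hg0 j t x) ht).trans
      (Finset.single_le_sum (f := fun j => ∑ t ∈ gapBox n j, g j t x)
        (fun j _ => Finset.sum_nonneg fun t _ => hg0 j t x) (Finset.mem_range.2 (by omega)))
  · rw [renewalIndicator_of_forall_ne (fun j hj => hex ⟨j, hj⟩), mul_zero]
    exact Finset.sum_nonneg fun j _ => Finset.sum_nonneg fun t _ => hg0 j t x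

end IsInterarrivalSequence
end Renewal

section Moments

variable {Ω Ω' : Type*} [MeasurableSpace Ω] [MeasurableSpace Ω']
  {P : Measure Ω} [IsProbabilityMeasure P] {Q : Measure Ω'}
  {K : ℕ → ℝ} {T : ℕ → Ω → ℕ} {ω : ℤ → Ω' → ℝ} {q : ℕ}

theorem IsFiniteRangeGaussian.aemeasurable_quenchedZ (hω : IsFiniteRangeGaussian Q ω q)
    (hT : ∀ k, Measurable (T k)) (n : ℕ) (β h : ℝ) :
    AEMeasurable (fun y => quenchedZ P T n β h (fun i => ω i y)) Q :=
  (measurable_quenchedZ hT n β h).comp_aemeasurable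
    (aemeasurable_pi_lambda _ fun i => (hω.integrable i).aemeasurable)

theorem exp_mul_gapEnergy_eq {Ω' : Type*} (ω : ℤ → Ω' → ℝ) (β h γ : ℝ) (t : ℕ → ℕ) (j : ℕ) :
    (fun y => Real.exp (γ * gapEnergy β h (fun i => ω i y) t j)) = fun y =>
      Real.exp (γ * h) ^ j *
        Real.exp (γ * β * ∑ i ∈ Finset.range j, ω (gapSum t (i + 1) : ℤ) y) := by
  funext y
  rw [gapEnergy_eq, ← Real.exp_nat_mul, ← Real.exp_add]
  ring_nf

theorem IsFiniteRangeGaussian.integrable_exp_gapEnergy (hω : IsFiniteRangeGaussian Q ω q)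
    (β h γ : ℝ) (t : ℕ → ℕ) (j : ℕ) :
    Integrable (fun y => Real.exp (γ * gapEnergy β h (fun i => ω i y) t j)) Q := by
  rw [exp_mul_gapEnergy_eq]
  exact (hω.integrable_exp_sum (fun i => (gapSum t (i + 1) : ℤ)) j (γ * β)).const_mul _

theorem IsFiniteRangeGaussian.integral_exp_gapEnergy (hω : IsFiniteRangeGaussian Q ω q)
    (β h γ : ℝ) (t : ℕ → ℕ) (j : ℕ) :
    ∫ y, Real.exp (γ * gapEnergy β h (fun i => ω i y) t j) ∂Q =
      Real.exp (γ * h) ^ j * Real.exp ((γ * β) ^ 2 * gapVariance Q ω t j / 2) := by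
  rw [exp_mul_gapEnergy_eq, integral_const_mul,
    hω.integral_exp_sum (fun i => (gapSum t (i + 1) : ℤ)) j (γ * β)]
  rfl

/-- Fractional moments of the partition function. -/
theorem integrable_quenchedZ_rpow_and_integral_le [IsProbabilityMeasure Q]
    (hω : IsFiniteRangeGaussian Q ω q)
    (hT : IsInterarrivalSequence P K T) (hK : K 0 = 0) (hK0 : ∀ n, 0 ≤ K n) {M : ℝ}
    (hM : ∀ t : ℕ → ℕ, (∀ i, 1 ≤ t i) → ∀ j : ℕ, gapVariance Q ω t j ≤ M * j)
    {γ : ℝ} (h0 : 0 < γ) (h1 : γ ≤ 1) (β h : ℝ) (n : ℕ) :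
    Integrable (fun y => quenchedZ P T n β h (fun i => ω i y) ^ γ) Q ∧
      ((∑ k ∈ Finset.Icc 1 n, K k ^ γ) * Real.exp (γ * h + (γ * β) ^ 2 * M / 2) ≤ 1 →
        ∫ y, quenchedZ P T n β h (fun i => ω i y) ^ γ ∂Q ≤ n + 1) := by
  set E := Real.exp (γ * h + (γ * β) ^ 2 * M / 2) with hE
  let B : Ω' → ℝ := fun y => ∑ j ∈ Finset.range (n + 1), ∑ t ∈ gapBox n j,
    (∏ i, K (t i) ^ γ) * Real.exp (γ * gapEnergy β h (fun i => ω i y) (extendGaps t) j)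
  have hterm : ∀ j (t : Fin j → ℕ), Integrable (fun y => (∏ i, K (t i) ^ γ) *
      Real.exp (γ * gapEnergy β h (fun i => ω i y) (extendGaps t) j)) Q := fun j t =>
    (hω.integrable_exp_gapEnergy β h γ (extendGaps t) j).const_mul _
  have hBi : Integrable B Q :=
    integrable_finsetSum _ fun j _ => integrable_finsetSum _ fun t _ => hterm j t
  have hle : ∀ y, quenchedZ P T n β h (fun i => ω i y) ^ γ ≤ B y := by
    intro y
    have hnn : ∀ j (t : Fin j → ℕ), 0 ≤ (∏ i, K (t i)) *
        Real.exp (gapEnergy β h (fun i => ω i y) (extendGaps t) j) := fun j t =>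
      mul_nonneg (Finset.prod_nonneg fun i _ => hK0 _) (Real.exp_pos _).le
    refine (Real.rpow_le_rpow (quenchedZ_nonneg n β h _)
      (hT.quenchedZ_le_sum hK n β h _) h0.le).trans ?_
    refine (rpow_finsetSum_le_finsetSum_rpow _
      (fun j => Finset.sum_nonneg fun t _ => hnn j t) h0 h1).trans ?_
    refine Finset.sum_le_sum fun j _ => ?_
    refine (rpow_finsetSum_le_finsetSum_rpow _ (fun t => hnn j t) h0 h1).trans (le_of_eq ?_)
    refine Finset.sum_congr rfl fun t _ => ?_
    rw [Real.mul_rpow (Finset.prod_nonneg fun i _ => hK0 _) (Real.exp_pos _).le,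
      Real.finsetProd_rpow _ _ (fun i _ => hK0 _), ← Real.exp_mul, mul_comm γ]
  have hBint : (∑ k ∈ Finset.Icc 1 n, K k ^ γ) * E ≤ 1 → ∫ y, B y ∂Q ≤ n + 1 := by
    intro hθ
    rw [integral_finsetSum _ fun j _ => integrable_finsetSum _ fun t _ => hterm j t]
    have hj : ∀ j ∈ Finset.range (n + 1), ∫ y, ∑ t ∈ gapBox n j, (∏ i, K (t i) ^ γ) *
        Real.exp (γ * gapEnergy β h (fun i => ω i y) (extendGaps t) j) ∂Q ≤ 1 := by
      intro j _
      rw [integral_finsetSum _ fun t _ => hterm j t]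
      calc _ ≤ ∑ t ∈ gapBox n j, ∏ i, (K (t i) ^ γ * E) := by
            refine Finset.sum_le_sum fun t ht => ?_
            rw [integral_const_mul, hω.integral_exp_gapEnergy, Finset.prod_mul_distrib,
              Finset.prod_const, Finset.card_univ, Fintype.card_fin]
            refine mul_le_mul_of_nonneg_left ?_
              (Finset.prod_nonneg fun i _ => Real.rpow_nonneg (hK0 _) _)
            rw [hE, ← Real.exp_nat_mul, ← Real.exp_nat_mul, ← Real.exp_add]
            refine Real.exp_le_exp.2 ?_
            have := mul_le_mul_of_nonneg_left (hM _ (one_le_extendGaps ht) j)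
              (sq_nonneg (γ * β))
            nlinarith
        _ = (∑ k ∈ Finset.Icc 1 n, K k ^ γ * E) ^ j := by
            rw [gapBox, ← Finset.prod_univ_sum (fun _ => Finset.Icc 1 n)
              (fun _ k => K k ^ γ * E), Finset.prod_const, Finset.card_univ, Fintype.card_fin]
        _ ≤ 1 := by
            rw [← Finset.sum_mul]
            refine pow_le_one₀ (mul_nonneg (Finset.sum_nonneg fun k _ =>
              Real.rpow_nonneg (hK0 _) _) (Real.exp_pos _).le) hθ
    refine (Finset.sum_le_sum hj).trans ?_
    simp
  have hnn : ∀ y, 0 ≤ quenchedZ P T n β h (fun i => ω i y) ^ γ := fun y =>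
    Real.rpow_nonneg (quenchedZ_nonneg n β h _) _
  refine ⟨hBi.mono' ((hω.aemeasurable_quenchedZ hT.measurable n β h).pow_const γ).aestronglyMeasurable
    (Eventually.of_forall fun y => ?_), fun hθ => ?_⟩
  · rw [Real.norm_of_nonneg (hnn y)]; exact hle y
  · exact (integral_mono_of_nonneg (Eventually.of_forall hnn) hBi
      (Eventually.of_forall hle)).trans (hBint hθ)

end Moments

theorem ae_tendsto_zero_of_integral_le {X : Type*} [MeasurableSpace X] {μ : Measure X}
    {f : ℕ → X → ℝ} {a : ℕ → ℝ} (hf : ∀ n, Integrable (f n) μ) (hf0 : ∀ n x, 0 ≤ f n x)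
    (ha : Summable a) (h : ∀ n, ∫ x, f n x ∂μ ≤ a n) :
    ∀ᵐ x ∂μ, Tendsto (fun n => f n x) atTop (𝓝 0) := by
  have hm : ∀ n, AEMeasurable (fun x => ENNReal.ofReal (f n x)) μ := fun n =>
    (hf n).aemeasurable.ennreal_ofReal
  have hfin : ∫⁻ x, ∑' n, ENNReal.ofReal (f n x) ∂μ ≠ ⊤ := by
    rw [lintegral_tsum hm]
    refine ne_top_of_le_ne_top ha.tsum_ofReal_ne_top (ENNReal.tsum_le_tsum fun n => ?_)
    rw [← ofReal_integral_eq_lintegral_ofReal (hf n) (Eventually.of_forall (hf0 n))]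
    exact ENNReal.ofReal_le_ofReal (h n)
  filter_upwards [ae_lt_top' (AEMeasurable.tsum hm) hfin] with x hx
  have h1 := (ENNReal.tendsto_toReal ENNReal.zero_ne_top).comp
    (ENNReal.tendsto_atTop_zero_of_tsum_ne_top hx.ne)
  refine h1.congr fun n => ?_
  simp [Function.comp, ENNReal.toReal_ofReal (hf0 n x)]

theorem ofReal_integral_le_lintegral_enorm {X : Type*} [MeasurableSpace X] {μ : Measure X}
    {f g : X → ℝ} (hf : Integrable f μ) (h : ∀ x, f x ≤ g x) :
    ENNReal.ofReal (∫ x, f x ∂μ) ≤ ∫⁻ x, ‖g x‖ₑ ∂μ := by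
  have h1 : ∫ x, f x ∂μ ≤ ∫ x, max (f x) 0 ∂μ :=
    integral_mono hf hf.pos_part fun x => le_max_left _ _
  refine (ENNReal.ofReal_le_ofReal h1).trans ?_
  rw [ofReal_integral_eq_lintegral_ofReal hf.pos_part
    (Eventually.of_forall fun x => le_max_right _ _)]
  refine lintegral_mono fun x => ?_
  rw [Real.enorm_eq_ofReal_abs]
  exact ENNReal.ofReal_le_ofReal (max_le ((h x).trans (le_abs_self _)) (abs_nonneg _))

theorem abs_log_le_of_mul_exp_le {z k e c γ : ℝ} (hk : 0 < k) (hγ : 0 < γ) (hc : 1 ≤ c)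
    (h : k * Real.exp e ≤ z) :
    |Real.log z| ≤ (z ^ γ / c + Real.log c) / γ + (|Real.log k| + |e|) := by
  have hke : 0 < k * Real.exp e := mul_pos hk (Real.exp_pos e)
  have hz : 0 < z := hke.trans_le h
  have hzγ : 0 < z ^ γ := Real.rpow_pos_of_pos hz γ
  have hc0 : 0 < c := by linarith
  have hlc : 0 ≤ Real.log c := Real.log_nonneg hc
  have h1 : Real.log k + e ≤ Real.log z := by
    have := Real.log_le_log hke h
    rwa [Real.log_mul hk.ne' (Real.exp_pos e).ne', Real.log_exp] at this
  have h2 : Real.log z ≤ (z ^ γ / c + Real.log c) / γ := by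
    rw [le_div_iff₀ hγ, mul_comm, ← Real.log_rpow hz]
    have h3 := Real.log_le_sub_one_of_pos (div_pos hzγ hc0)
    rw [Real.log_div hzγ.ne' hc0.ne'] at h3
    linarith
  have h4 : 0 ≤ (z ^ γ / c + Real.log c) / γ := by positivity
  rw [abs_le]
  constructor <;> linarith [neg_abs_le (Real.log k), neg_abs_le e, abs_nonneg (Real.log k),
    abs_nonneg e]

theorem tendsto_log_natCast_succ_div :
    Tendsto (fun n : ℕ => Real.log (n + 1) / n) atTop (𝓝 0) := by
  have h0 : Tendsto (fun n : ℕ => Real.log n / n + 1 / (n : ℝ)) atTop (𝓝 0) := by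
    simpa using tendsto_log_natCast_div.add (tendsto_const_div_atTop_nhds_zero_nat (1 : ℝ))
  refine squeeze_zero' (Eventually.of_forall fun n => ?_) ?_ h0
  · have : (0 : ℝ) ≤ n := n.cast_nonneg
    exact div_nonneg (Real.log_nonneg (by linarith)) this
  · filter_upwards [eventually_ge_atTop 1] with n hn
    have hn0 : (1 : ℝ) ≤ n := by exact_mod_cast hn
    rw [← add_div]
    gcongr
    have h1 := Real.log_le_sub_one_of_pos (show (0 : ℝ) < (n + 1) / n by positivity)
    rw [Real.log_div (by positivity) (by positivity), add_div, div_self (by positivity)] at h1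
    have : 1 / (n : ℝ) ≤ 1 := by rw [div_le_one (by positivity)]; exact hn0
    linarith

/-- The normalized a priori bound on the logarithm of the partition function is negligible. -/
theorem tendsto_log_bound_zero {K : ℕ → ℝ}
    (hK : Tendsto (fun n : ℕ => |Real.log (K n)| / n) atTop (𝓝 0)) {a e : ℕ → ℝ}
    (ha : Tendsto (fun n : ℕ => a n / n) atTop (𝓝 0))
    (he : Tendsto (fun n : ℕ => e n / n) atTop (𝓝 0)) (γ c : ℝ) :
    Tendsto (fun n : ℕ => 1 / (n : ℝ) * ((a n + c * Real.log (n + 1)) / γ +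
      (|Real.log (K n)| + e n))) atTop (𝓝 0) := by
  have := ((ha.add (tendsto_log_natCast_succ_div.const_mul c)).div_const γ).add (hK.add he)
  simp only [mul_zero, add_zero, zero_div] at this
  refine this.congr fun n => ?_
  ring

theorem summable_one_div_natCast_succ_sq : Summable (fun n : ℕ => 1 / ((n : ℝ) + 1) ^ 2) := by
  have := (summable_nat_add_iff 1).2 (Real.summable_one_div_nat_pow.2 (show 1 < 2 by norm_num))
  simpa using this

section Criteria

variable {Ω Ω' : Type*} [MeasurableSpace Ω] [MeasurableSpace Ω']
  {P : Measure Ω} [IsProbabilityMeasure P] {Q : Measure Ω'}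
  {K : ℕ → ℝ} {T : ℕ → Ω → ℕ} {ω : ℤ → Ω' → ℝ} {q : ℕ}

theorem IsInterarrivalSequence.sum_le_one (hT : IsInterarrivalSequence P K T) (s : Finset ℕ) :
    ∑ k ∈ s, K k ≤ 1 := by
  have h := sum_measureReal_preimage_singleton (μ := P) s (f := T 0)
    (fun k _ => hT.measurable 0 (measurableSet_singleton k))
  rw [← Finset.sum_congr rfl fun k _ => hT.law 0 k]
  exact h.le.trans measureReal_le_one

theorem gapSum_one (n : ℕ) : gapSum (fun _ => n) 1 = n := by simp [gapSum]

theorem IsInterarrivalSequence.mul_exp_le_quenchedZ (hT : IsInterarrivalSequence P K T)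
    (hK : K 0 = 0) (n : ℕ) (β h : ℝ) (w : ℤ → ℝ) :
    K n * Real.exp (β * w n + h) ≤ quenchedZ P T n β h w := by
  simpa [gapEnergy, gapSum_one] using hT.prod_mul_exp_le_quenchedZ hK (gapSum_one n) β h w

/-- If the fractional moments grow at most linearly, the quenched free energy vanishes. -/
theorem mem_quenchedDelocalized (hω : IsFiniteRangeGaussian Q ω q) [IsProbabilityMeasure Q]
    (hT : IsInterarrivalSequence P K T) (hK : K 0 = 0) (hKpos : ∀ n, 1 ≤ n → 0 < K n)
    (hKlog : Tendsto (fun n : ℕ => |Real.log (K n)| / n) atTop (𝓝 0)) {γ β h : ℝ} (hγ : 0 < γ)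
    (hi : ∀ n, Integrable (fun y => quenchedZ P T n β h (fun i => ω i y) ^ γ) Q)
    (hle : ∀ n : ℕ, ∫ y, quenchedZ P T n β h (fun i => ω i y) ^ γ ∂Q ≤ n + 1) :
    h ∈ quenchedDelocalized P T Q ω β := by
  set Z : ℕ → Ω' → ℝ := fun n y => quenchedZ P T n β h (fun i => ω i y) with hZ
  have hZ0 : ∀ n y, 0 ≤ Z n y ^ γ := fun n y => Real.rpow_nonneg (quenchedZ_nonneg n β h _) _
  have hbound : ∀ n : ℕ, 1 ≤ n → ∀ y, ∀ c : ℝ, 1 ≤ c → |1 / (n : ℝ) * Real.log (Z n y)| ≤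
      1 / (n : ℝ) * ((Z n y ^ γ / c + Real.log c) / γ +
        (|Real.log (K n)| + (|β| * |ω n y| + |h|))) := by
    intro n hn y c hc
    rw [abs_mul, abs_of_nonneg (by positivity : (0 : ℝ) ≤ 1 / n)]
    refine mul_le_mul_of_nonneg_left ?_ (by positivity)
    refine (abs_log_le_of_mul_exp_le (hKpos n hn) hγ hc
      (hT.mul_exp_le_quenchedZ hK n β h (fun i => ω i y))).trans ?_
    have : |β * ω n y + h| ≤ |β| * |ω n y| + |h| := by
      rw [← abs_mul]; exact abs_add_le _ _
    simp only [hZ]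
    linarith
  refine ⟨?_, ?_⟩
  · have h1 : ∀ᵐ y ∂Q, Tendsto (fun n : ℕ => Z n y ^ γ / ((n : ℝ) + 1) ^ 3) atTop (𝓝 0) := by
      refine ae_tendsto_zero_of_integral_le (fun n => (hi n).div_const _)
        (fun n y => div_nonneg (hZ0 n y) (by positivity)) summable_one_div_natCast_succ_sq
        fun n => ?_
      rw [integral_div, div_le_div_iff₀ (by positivity) (by positivity)]
      have h2 := mul_le_mul_of_nonneg_right (hle n) (by positivity : (0 : ℝ) ≤ ((n : ℝ) + 1) ^ 2)
      linarith
    have h2 : ∀ᵐ y ∂Q, Tendsto (fun n : ℕ => ω n y ^ 2 / (n : ℝ) ^ 2) atTop (𝓝 0) := by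
      refine ae_tendsto_zero_of_integral_le (fun n => ((hω.memLp_two n).integrable_sq).div_const _)
        (fun n y => by positivity) (Real.summable_one_div_nat_pow.2 (show 1 < 2 by norm_num))
        fun n => ?_
      rw [integral_div, hω.integral_sq]
    filter_upwards [h1, h2] with y hy1 hy2
    have hy3 : Tendsto (fun n : ℕ => (|β| * |ω n y| + |h|) / n) atTop (𝓝 0) := by
      have hs := (Real.continuous_sqrt.tendsto 0).comp hy2
      rw [Real.sqrt_zero] at hs
      have hs' : Tendsto (fun n : ℕ => |ω n y| / n) atTop (𝓝 0) := by
        refine hs.congr fun n => ?_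
        simp only [Function.comp]
        rw [Real.sqrt_div (sq_nonneg _), Real.sqrt_sq_eq_abs, Real.sqrt_sq n.cast_nonneg]
      have := (hs'.const_mul |β|).add (tendsto_const_div_atTop_nhds_zero_nat |h|)
      rw [mul_zero, zero_add] at this
      refine this.congr fun n => ?_
      ring
    have hy4 : Tendsto (fun n : ℕ => Z n y ^ γ / ((n : ℝ) + 1) ^ 3 / n) atTop (𝓝 0) := by
      have := hy1.mul (tendsto_const_div_atTop_nhds_zero_nat (1 : ℝ))
      rw [zero_mul] at this
      exact this.congr fun n => by rw [mul_one_div]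
    refine squeeze_zero_norm' ?_ (tendsto_log_bound_zero hKlog hy4 hy3 γ 3)
    filter_upwards [eventually_ge_atTop 1] with n hn
    rw [Real.norm_eq_abs]
    have h3 := hbound n hn y (((n : ℝ) + 1) ^ 3) (one_le_pow₀ (by
      have : (0 : ℝ) ≤ n := n.cast_nonneg
      linarith))
    rw [Real.log_pow] at h3
    exact_mod_cast h3
  · have hWi : ∀ n : ℕ, Integrable (fun y => |β| * |ω n y| + |h|) Q := fun n =>
      ((hω.integrable n).abs.const_mul |β|).add (integrable_const |h|)
    let B : ℕ → Ω' → ℝ := fun n y => 1 / (n : ℝ) * ((Z n y ^ γ / ((n : ℝ) + 1) +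
      Real.log ((n : ℝ) + 1)) / γ + (|Real.log (K n)| + (|β| * |ω n y| + |h|)))
    have hJi : ∀ n : ℕ, Integrable (fun y => |Real.log (K n)| + (|β| * |ω n y| + |h|)) Q :=
      fun n => (integrable_const _).add (hWi n)
    have hIi : ∀ n : ℕ, Integrable (fun y => (Z n y ^ γ / ((n : ℝ) + 1) +
      Real.log ((n : ℝ) + 1)) / γ) Q :=
      fun n => (((hi n).div_const _).add (integrable_const _)).div_const _
    have hBi : ∀ n, Integrable (B n) Q := fun n => ((hIi n).add (hJi n)).const_mul _
    have hB : ∀ n : ℕ, ∫ y, B n y ∂Q ≤ 1 / (n : ℝ) * ((1 + 1 * Real.log (n + 1)) / γ +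
        (|Real.log (K n)| + (|β| + |h|))) := by
      intro n
      have hab : ∫ y, |ω n y| ∂Q ≤ 1 := by
        have h1 : ∫ y, |ω n y| ∂Q ≤ ∫ y, (1 / 2 + ω n y ^ 2 / 2) ∂Q := by
          refine integral_mono (hω.integrable n).abs
            ((integrable_const _).add ((hω.memLp_two n).integrable_sq.div_const _)) fun y => ?_
          have := sq_nonneg (|ω n y| - 1)
          simp only
          nlinarith [sq_abs (ω n y)]
        rw [integral_add (integrable_const _) ((hω.memLp_two n).integrable_sq.div_const _),
          integral_const, integral_div, hω.integral_sq, probReal_univ, one_smul] at h1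
        linarith
      have hq : (∫ y, Z n y ^ γ ∂Q) / ((n : ℝ) + 1) ≤ 1 := by
        rw [div_le_one (by positivity)]; exact hle n
      simp only [B]
      rw [integral_const_mul, integral_add (hIi n) (hJi n), integral_div,
        integral_add ((hi n).div_const _) (integrable_const _), integral_div,
        integral_add (integrable_const _) (hWi n),
        integral_add ((hω.integrable n).abs.const_mul |β|) (integrable_const |h|),
        integral_const_mul]
      simp only [integral_const, probReal_univ, one_smul, one_mul]
      have := mul_le_mul_of_nonneg_left hab (abs_nonneg β)
      refine mul_le_mul_of_nonneg_left ?_ (by positivity)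
      gcongr
      linarith
    have hlim := tendsto_log_bound_zero hKlog
      (tendsto_const_div_atTop_nhds_zero_nat (1 : ℝ))
      (tendsto_const_div_atTop_nhds_zero_nat (|β| + |h|)) γ 1
    have hlim' := ENNReal.tendsto_ofReal hlim
    rw [ENNReal.ofReal_zero] at hlim'
    refine tendsto_of_tendsto_of_tendsto_of_le_of_le' tendsto_const_nhds hlim'
      (Eventually.of_forall fun n => zero_le) ?_
    filter_upwards [eventually_ge_atTop 1] with n hn
    have hle' : ∀ y, |1 / (n : ℝ) * Real.log (Z n y)| ≤ B n y := fun y =>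
      hbound n hn y ((n : ℝ) + 1) (by
        have : (0 : ℝ) ≤ n := n.cast_nonneg
        linarith)
    rw [eLpNorm_one_eq_lintegral_enorm]
    refine le_trans (lintegral_mono fun y => ?_) ((ofReal_integral_eq_lintegral_ofReal (hBi n)
      (Eventually.of_forall fun y => (abs_nonneg _).trans (hle' y))).symm.le.trans
        (ENNReal.ofReal_le_ofReal (hB n)))
    rw [sub_zero, Real.enorm_eq_ofReal_abs]
    exact ENNReal.ofReal_le_ofReal (hle' y)

theorem prod_mul_exp_le_annealedZ (hω : IsFiniteRangeGaussian Q ω q)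
    (hT : IsInterarrivalSequence P K T) (hK : K 0 = 0) {t : ℕ → ℕ} {n j : ℕ}
    (hn : gapSum t j = n) {β h : ℝ}
    (hi : Integrable (fun y => quenchedZ P T n β h (fun i => ω i y)) Q) :
    (∏ i ∈ Finset.range j, K (t i)) * Real.exp (j * h + β ^ 2 * gapVariance Q ω t j / 2) ≤
      annealedZ P T Q ω n β h := by
  have h1 := hω.integrable_exp_gapEnergy β h 1 t j
  have h2 := hω.integral_exp_gapEnergy β h 1 t j
  simp only [one_mul] at h1 h2
  have h3 : ∫ y, (∏ i ∈ Finset.range j, K (t i)) *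
      Real.exp (gapEnergy β h (fun i => ω i y) t j) ∂Q ≤ annealedZ P T Q ω n β h :=
    integral_mono (h1.const_mul _) hi fun y => hT.prod_mul_exp_le_quenchedZ hK hn β h _
  rwa [integral_const_mul, h2, ← Real.exp_nat_mul, ← Real.exp_add] at h3

theorem mem_annealedDelocalized (hω : IsFiniteRangeGaussian Q ω q)
    (hT : IsInterarrivalSequence P K T) (hK : K 0 = 0) (hKpos : ∀ n, 1 ≤ n → 0 < K n)
    (hKlog : Tendsto (fun n : ℕ => |Real.log (K n)| / n) atTop (𝓝 0)) {β h : ℝ}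
    (hi : ∀ n, Integrable (fun y => quenchedZ P T n β h (fun i => ω i y)) Q)
    (hle : ∀ n : ℕ, ∫ y, quenchedZ P T n β h (fun i => ω i y) ∂Q ≤ n + 1) :
    h ∈ annealedDelocalized P T Q ω β := by
  have hlim := tendsto_log_bound_zero hKlog
    (tendsto_const_div_atTop_nhds_zero_nat (1 : ℝ))
    (tendsto_const_div_atTop_nhds_zero_nat (|h|)) 1 1
  refine squeeze_zero_norm' ?_ hlim
  filter_upwards [eventually_ge_atTop 1] with n hn
  have h0 : K n * Real.exp h ≤ annealedZ P T Q ω n β h := by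
    refine le_trans (mul_le_mul_of_nonneg_left (Real.exp_le_exp.2 ?_) (hKpos n hn).le)
      (by simpa using prod_mul_exp_le_annealedZ hω hT hK (gapSum_one n) (hi n))
    have : 0 ≤ gapVariance Q ω (fun _ => n) 1 := variance_nonneg _ _
    linarith [mul_nonneg (sq_nonneg β) this]
  have hn1 : (1 : ℝ) ≤ n + 1 := by
    have : (0 : ℝ) ≤ n := n.cast_nonneg
    linarith
  have h1 := abs_log_le_of_mul_exp_le (hKpos n hn) one_pos hn1 h0
  rw [Real.norm_eq_abs, abs_mul, abs_of_nonneg (by positivity : (0 : ℝ) ≤ 1 / n)]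
  refine mul_le_mul_of_nonneg_left (h1.trans ?_) (by positivity)
  have h2 : annealedZ P T Q ω n β h ^ (1 : ℝ) / ((n : ℝ) + 1) ≤ 1 := by
    rw [Real.rpow_one, div_le_one (by positivity)]
    exact hle n
  gcongr
  simp

/-- The sequence of gaps `spacedRepeat` yields an upper bound for delocalized parameters of the
annealed model. -/
theorem log_prod_add_le_zero_of_mem_annealedDelocalized (hω : IsFiniteRangeGaussian Q ω q)
    [IsProbabilityMeasure Q]
    (hT : IsInterarrivalSequence P K T) (hK : K 0 = 0) (hKpos : ∀ n, 1 ≤ n → 0 < K n)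
    {β h : ℝ} (hi : ∀ n, Integrable (fun y => quenchedZ P T n β h (fun i => ω i y)) Q)
    {t : ℕ → ℕ} (ht : ∀ i, 1 ≤ t i) {j : ℕ} (hj : 0 < j)
    (hh : h ∈ annealedDelocalized P T Q ω β) :
    Real.log (∏ i ∈ Finset.range j, K (spacedRepeat q j t i)) + j * h +
      β ^ 2 * gapVariance Q ω t j / 2 ≤ 0 := by
  set κ := ∏ i ∈ Finset.range j, K (spacedRepeat q j t i) with hκ
  have hκ0 : 0 < κ := Finset.prod_pos fun i _ => hKpos _ (one_le_spacedRepeat ht i)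
  set p := gapSum (spacedRepeat q j t) j with hp
  have hp0 : 0 < p := strictMono_gapSum (one_le_spacedRepeat ht) hj
  have hpR : (0 : ℝ) < p := by exact_mod_cast hp0
  have hsub : Tendsto (fun m : ℕ => m * p) atTop atTop := tendsto_id.atTop_mul_const' hp0
  have hlim := Tendsto.comp hh hsub
  suffices (Real.log κ + j * h + β ^ 2 * gapVariance Q ω t j / 2) / p ≤ 0 by
    rwa [div_le_iff₀ hpR, zero_mul] at this
  refine ge_of_tendsto hlim ?_
  filter_upwards [eventually_ge_atTop 1] with m hm
  have hm0 : (0 : ℝ) < m := by exact_mod_cast hm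
  have h1 := prod_mul_exp_le_annealedZ hω hT hK (gapSum_spacedRepeat_mul q j t m) (hi (m * p))
  rw [prod_range_of_periodic (f := fun i => K (spacedRepeat q j t i))
    (fun i => by rw [spacedRepeat_add]) m, hω.gapVariance_spacedRepeat ht hj m] at h1
  have h2 := Real.log_le_log (mul_pos (pow_pos hκ0 m) (Real.exp_pos _)) h1
  rw [Real.log_mul (pow_pos hκ0 m).ne' (Real.exp_pos _).ne', Real.log_exp, Real.log_pow] at h2
  simp only [Function.comp]
  rw [div_le_iff₀ hpR]
  push_cast at h2 ⊢
  have h3 : ∀ x : ℝ, 1 / ((m : ℝ) * p) * x * p = x / m := fun x => by field_simp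
  rw [h3, le_div_iff₀ hm0]
  linarith

/-- Visiting every site yields an upper bound for delocalized parameters of the quenched model. -/
theorem log_add_le_zero_of_mem_quenchedDelocalized (hω : IsFiniteRangeGaussian Q ω q)
    [IsProbabilityMeasure Q]
    (hT : IsInterarrivalSequence P K T) (hK : K 0 = 0) (hKpos : ∀ n, 1 ≤ n → 0 < K n)
    {β h : ℝ} (hh : h ∈ quenchedDelocalized P T Q ω β) :
    Real.log (K 1) + h ≤ 0 := by
  have hsum : ∀ n, gapSum (fun _ => 1) n = n := fun n => by simp [gapSum]
  have hlim := hh.2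
  suffices ENNReal.ofReal (Real.log (K 1) + h) ≤ 0 by simpa using this
  refine ge_of_tendsto hlim ?_
  filter_upwards [eventually_ge_atTop 1] with n hn
  have hn0 : (0 : ℝ) < n := by exact_mod_cast hn
  rw [eLpNorm_one_eq_lintegral_enorm]
  let S : Ω' → ℝ := fun y => ∑ i ∈ Finset.range n, ω (gapSum (fun _ => 1) (i + 1) : ℤ) y
  have hSi : Integrable S Q :=
    (hω.memLp_two_sum (fun i => (gapSum (fun _ => 1) (i + 1) : ℤ)) n).integrable one_le_two
  have hS0 : ∫ y, S y ∂Q = 0 := hω.integral_sum (fun i => (gapSum (fun _ => 1) (i + 1) : ℤ)) n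
  have h1 : ∫ y, (Real.log (K 1) + h + β / n * S y) ∂Q = Real.log (K 1) + h := by
    rw [integral_add (integrable_const _) (hSi.const_mul _), integral_const_mul, hS0]
    simp
  rw [← h1]
  refine ofReal_integral_le_lintegral_enorm ((integrable_const _).add (hSi.const_mul _))
    fun y => ?_
  have h2 := hT.prod_mul_exp_le_quenchedZ hK (hsum n) β h (fun i => ω i y)
  rw [Finset.prod_const, Finset.card_range, gapEnergy_eq] at h2
  have h3 := Real.log_le_log (mul_pos (pow_pos (hKpos 1 le_rfl) n) (Real.exp_pos _)) h2
  rw [Real.log_mul (pow_pos (hKpos 1 le_rfl) n).ne' (Real.exp_pos _).ne', Real.log_exp,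
    Real.log_pow] at h3
  rw [sub_zero, one_div, ← div_eq_inv_mul, le_div_iff₀ hn0]
  refine le_trans (le_of_eq ?_) h3
  simp only [S]
  field_simp
  ring

/-- The largest variance per renewal point. -/
theorem exists_isLUB_gapVariance (hω : IsFiniteRangeGaussian Q ω q) [IsProbabilityMeasure Q] :
    ∃ M : ℝ, 0 < M ∧ (∀ t : ℕ → ℕ, (∀ i, 1 ≤ t i) → ∀ j : ℕ, gapVariance Q ω t j ≤ M * j) ∧
      ∀ m < M, ∃ t : ℕ → ℕ, (∀ i, 1 ≤ t i) ∧ ∃ j : ℕ, 0 < j ∧ m * j < gapVariance Q ω t j := by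
  let A : Set ℝ := {x | ∃ t : ℕ → ℕ, (∀ i, 1 ≤ t i) ∧ ∃ j : ℕ, 0 < j ∧
    gapVariance Q ω t j / j = x}
  have hbdd : BddAbove A := by
    refine ⟨2 * q + 1, ?_⟩
    rintro x ⟨t, ht, j, hj, rfl⟩
    have hj0 : (0 : ℝ) < j := by exact_mod_cast hj
    rw [div_le_iff₀ hj0]
    exact hω.variance_sum_le (strictMono_natCast_gapSum_succ ht) j
  have h1 : (1 : ℝ) ∈ A := by
    refine ⟨fun _ => 1, fun _ => le_rfl, 1, one_pos, ?_⟩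
    have := hω.variance_one 1
    simpa [gapVariance, gapSum] using this
  refine ⟨sSup A, one_pos.trans_le (le_csSup hbdd h1), fun t ht j => ?_, fun m hm => ?_⟩
  · rcases Nat.eq_zero_or_pos j with rfl | hj
    · simp only [gapVariance, Finset.range_zero, Finset.sum_empty, Nat.cast_zero, mul_zero]
      exact (variance_zero Q).le
    · have hj0 : (0 : ℝ) < j := by exact_mod_cast hj
      rw [← div_le_iff₀ hj0]
      exact le_csSup hbdd ⟨t, ht, j, hj, rfl⟩
  · obtain ⟨_, ⟨t, ht, j, hj, rfl⟩, hlt⟩ := exists_lt_of_lt_csSup ⟨1, h1⟩ hm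
    exact ⟨t, ht, j, hj, (lt_div_iff₀ (by exact_mod_cast hj)).1 hlt⟩

end Criteria

theorem exists_forall_lt_sq_mul {d D : ℝ} (hd : 0 < d) :
    ∃ β₀ : ℝ, 0 ≤ β₀ ∧ ∀ β : ℝ, β₀ < β → D < β ^ 2 * d := by
  refine ⟨1 + |D| / d, by positivity, fun β hβ => ?_⟩
  have h0 : 0 ≤ |D| / d := by positivity
  have h1 : |D| / d < β := by linarith
  have h2 : |D| < β * d := (div_lt_iff₀ hd).1 h1
  have h3 : β * d ≤ β ^ 2 * d := by
    refine mul_le_mul_of_nonneg_right ?_ hd.le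
    nlinarith
  linarith [le_abs_self D]

end Pinning

end

/-- The two `IsLUB` clauses say that the suprema defining the critical points are genuine (finite)
suprema, so that the strict inequality is not one between junk values. -/
theorem theorem2p2 {Ω Ω' : Type*} [MeasurableSpace Ω] [MeasurableSpace Ω']
    (P : Measure Ω) [IsProbabilityMeasure P] (Q : Measure Ω') [IsProbabilityMeasure Q]
    (α : ℝ) (hα : α ∈ Set.Ioo (0 : ℝ) (1 / 2))
    (L : ℝ → ℝ) (hL : Pinning.IsSlowlyVarying L)
    (T : ℕ → Ω → ℕ)
    (hT : Pinning.IsInterarrivalSequence P (Pinning.interarrivalMass L α) T)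
    (q : ℕ) (hq : 1 ≤ q)
    (ω : ℤ → Ω' → ℝ) (hω : Pinning.IsFiniteRangeGaussian Q ω q) :
    ∃ β₀ : ℝ, 0 ≤ β₀ ∧ ∀ β : ℝ, β₀ < β →
      IsLUB (Pinning.quenchedDelocalized P T Q ω β) (Pinning.quenchedCritical P T Q ω β) ∧
      IsLUB (Pinning.annealedDelocalized P T Q ω β) (Pinning.annealedCritical P T Q ω β) ∧
      Pinning.annealedCritical P T Q ω β < Pinning.quenchedCritical P T Q ω β := by
  open Pinning in
  set K := interarrivalMass L α with hKdef
  have hK : K 0 = 0 := interarrivalMass_zero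
  have hK0 : ∀ n, 0 ≤ K n := interarrivalMass_nonneg hL
  have hKpos : ∀ n, 1 ≤ n → 0 < K n := fun n hn => interarrivalMass_pos hL hn
  have hKlog : Tendsto (fun n : ℕ => |Real.log (K n)| / n) atTop (𝓝 0) :=
    tendsto_abs_log_interarrivalMass_div hL
  obtain ⟨γ, hγ0, hγ1, hγs⟩ := exists_summable_interarrivalMass_rpow hL hα.1
  obtain ⟨M, hM0, hM, hMlub⟩ := exists_isLUB_gapVariance hω
  obtain ⟨t, ht, j, hj, hjV⟩ := hMlub (γ * M) (by nlinarith)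
  have hjR : (0 : ℝ) < j := by exact_mod_cast hj
  set V := gapVariance Q ω t j with hV
  set S := ∑' n, K n ^ γ with hS
  have hnn : ∀ n, 0 ≤ K n ^ γ := fun n => Real.rpow_nonneg (hK0 n) γ
  have hS0 : 0 < S := hγs.tsum_pos hnn 1 (Real.rpow_pos_of_pos (hKpos 1 le_rfl) γ)
  set κ := ∏ i ∈ Finset.range j, K (spacedRepeat q j t i) with hκ
  obtain ⟨β₀, hβ₀, hβ⟩ := exists_forall_lt_sq_mul (D := j * Real.log S / γ - Real.log κ)
    (d := (V - γ * M * j) / 2) (by linarith)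
  refine ⟨β₀, hβ₀, fun β hβlt => ?_⟩
  have hint : ∀ h n, Integrable (fun y => quenchedZ P T n β h (fun i => ω i y)) Q := fun h n => by
    simpa using (integrable_quenchedZ_rpow_and_integral_le hω hT hK hK0 hM one_pos le_rfl β h n).1
  have hqmem : -(γ * β ^ 2 * M / 2) - Real.log S / γ ∈ quenchedDelocalized P T Q ω β := by
    have hmom := integrable_quenchedZ_rpow_and_integral_le hω hT hK hK0 hM hγ0 hγ1.le β
      (-(γ * β ^ 2 * M / 2) - Real.log S / γ)
    refine mem_quenchedDelocalized hω hT hK hKpos hKlog hγ0 (fun n => (hmom n).1)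
      fun n => (hmom n).2 ?_
    have he : γ * (-(γ * β ^ 2 * M / 2) - Real.log S / γ) + (γ * β) ^ 2 * M / 2
        = -Real.log S := by field_simp; ring
    rw [he, Real.exp_neg, Real.exp_log hS0, ← div_eq_mul_inv, div_le_one hS0]
    exact hγs.sum_le_tsum _ fun n _ => hnn n
  have hamem : -(β ^ 2 * M / 2) ∈ annealedDelocalized P T Q ω β := by
    have hmom := fun n => (integrable_quenchedZ_rpow_and_integral_le hω hT hK hK0 hM one_pos
      le_rfl β (-(β ^ 2 * M / 2)) n).2
    refine mem_annealedDelocalized hω hT hK hKpos hKlog (hint _) fun n => ?_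
    simp only [Real.rpow_one, one_mul, neg_add_cancel, Real.exp_zero, mul_one] at hmom
    exact hmom n (hT.sum_le_one _)
  have hqlub : IsLUB (quenchedDelocalized P T Q ω β) (quenchedCritical P T Q ω β) :=
    isLUB_csSup ⟨_, hqmem⟩ ⟨-Real.log (K 1), fun h hh => by
      linarith [log_add_le_zero_of_mem_quenchedDelocalized hω hT hK hKpos hh]⟩
  have hann : ∀ h ∈ annealedDelocalized P T Q ω β, h ≤ -((Real.log κ + β ^ 2 * V / 2) / j) :=
    fun h hh => by
      have := log_prod_add_le_zero_of_mem_annealedDelocalized hω hT hK hKpos (hint h) ht hj hh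
      rw [← neg_div, le_div_iff₀ hjR]
      linarith
  have halub : IsLUB (annealedDelocalized P T Q ω β) (annealedCritical P T Q ω β) :=
    isLUB_csSup ⟨_, hamem⟩ ⟨_, hann⟩
  refine ⟨hqlub, halub, (halub.2 hann).trans_lt (lt_of_lt_of_le ?_ (hqlub.1 hqmem))⟩
  have h1 := hβ β hβlt
  rw [← neg_div, div_lt_iff₀ hjR]
  have h2 : (-(γ * β ^ 2 * M / 2) - Real.log S / γ) * j =
      -(γ * β ^ 2 * M / 2) * j - j * Real.log S / γ := by ring
  rw [h2]
  linarith
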